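/- Let $T>0$, $\lambda>0$. Let $N=(N(t))_{t\in[0,T]}$ be a homogeneous Poisson process with intensity $\lambda$ and let $Y_1,Y_2,\dots$ be i.i.d. positive random variables, independent of $N$, with distribution function $F$ and $\mathbb E[Y^2]<\infty$, where $Y\sim F$. Let $N(\mathrm ds,\mathrm dy)$ be the random measure with a unit mass at (arrival time, size) of each claim up to time $T$. Let $\xi:[\gamma_L,\gamma_H]\to[0,\infty)$ be a loading function, $0\le\gamma_L\le\gamma_H$. Let $\gamma\in[\gamma_L,\gamma_H]$, $\gamma>0$, be the customer's true risk aversion, $\tilde\gamma\in[\gamma_L,\gamma_H]$ the reported one, and $x_C>0$ the initial surplus. Coverage functions are deterministic measurable functions $l(t,y)$ on $[0,T]\times(0,\infty)$. The admissible set $\mathcal A_l$ is any set of such functions all of which satisfy $l\ge 0$ and $\int_0^T\!\int_0^\infty l(t,y)^2\,\mathrm dF(y)\,\mathrm dt<\infty$, and which contains every $l$ with $0\le l(t,y)\le y$. The premium rate is $p(l;\tilde\gamma)(t)=(1+\xi(\tilde\gamma))\lambda\int_0^\infty l(t,y)\,\mathrm dF(y)$. For $0\le t\le u\le T$, the surplus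 started from $x$ at time $t$ is $$X^{t,x}_C(u,l;\tilde\gamma)=x-\int_t^u p(l;\tilde\gamma)(s)\,\mathrm ds-\int_{(t,u]}\int_0^\infty (y-l(s,y))\,N(\mathrm ds,\mathrm dy),$$ and $J^\gamma(t,x,l;\tilde\gamma)=\mathbb E[X^{t,x}_C(T,l;\tilde\gamma)]-\frac{\gamma}{2}\mathrm{Var}[X^{t,x}_C(T,l;\tilde\gamma)]$. Put $V_C^\gamma(\tilde\gamma)=\sup_{l\in\mathcal A_l}J^\gamma(0,x_C,l;\tilde\gamma)$. A strategy $\hat l\in\mathcal A_l$ is an equilibrium strategy if $$\liminf_{\varepsilon\downarrow0}\frac{J^\gamma(t,x,\hat l;\tilde\gamma)-J^\gamma(t,x,l^\varepsilon;\tilde\gamma)}{\varepsilon}\ge0$$ for all $(t,x)\in[0,T]\times\mathbb R$ and all $\bar l$ such that the strategy $l^\varepsilon$ equal to $\bar l(y)$ at times in $[t,t+\varepsilon)$ and to $\hat l$ at other times is admissible for all small $\varepsilon>0$. **Theorem.** The random variable $X_C^{t,x}(T,l;\tilde\gamma)$ is square integrable for all $l\in\mathcal A_l$, $t\in[0,T]$,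 $x\in\mathbb R$. The coverage $$\hat l^\gamma(y;\tilde\gamma)=\Bigl(y-\frac{\xi(\tilde\gamma)}{\gamma}\Bigr)_+$$ is an equilibrium strategy, it attains the supremum defining $V_C^\gamma(\tilde\gamma)$, and the value function, which is also the value $J^\gamma(0,x_C,\hat l^\gamma;\tilde\gamma)$ of this equilibrium, is $$V_C^\gamma(\tilde\gamma)=x_C-\lambda T\left(\mathbb E[Y]+\xi(\tilde\gamma)\int_{(\xi(\tilde\gamma)/\gamma,\infty)}\Bigl(y-\frac{\xi(\tilde\gamma)}{\gamma}\Bigr)\mathrm dF(y)+\frac{\gamma}{2}\int_0^\infty\Bigl(y\wedge\frac{\xi(\tilde\gamma)}{\gamma}\Bigr)^2\mathrm dF(y)\right).$$ -/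

import Mathlib

open MeasureTheory ProbabilityTheory Set Filter
open scoped Topology

/-- `N = (N t)_{t ∈ [0,T]}` is a homogeneous Poisson process with intensity `lam`: it starts at `0`,
its paths are nondecreasing and right-continuous, its increments are independent, and
`N t - N s` is Poisson distributed with parameter `lam * (t - s)`. Only the times in `[0,T]`
matter. (The subtraction in `law` is that of `ℕ`; it is the true one as paths are monotone.) -/
structure IsPoissonProcess {Ω : Type*} [MeasurableSpace Ω] (P : Measure Ω) (T lam : ℝ)
    (N : ℝ → Ω → ℕ) : Prop where
  measurable : ∀ t ∈ Icc 0 T, Measurable (N t)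
  zero : ∀ᵐ ω ∂P, N 0 ω = 0
  mono : ∀ᵐ ω ∂P, MonotoneOn (fun t => N t ω) (Icc 0 T)
  rightCont : ∀ᵐ ω ∂P, ∀ t ∈ Ico 0 T, ContinuousWithinAt (fun s => N s ω) (Ici t) t
  indepIncrements : HasIndepIncrements (fun (t : Icc (0 : ℝ) T) ω => (N t ω : ℤ)) P
  law : ∀ s t, 0 ≤ s → s ≤ t → t ≤ T →
    HasLaw (fun ω => N t ω - N s ω) (poissonMeasure (lam * (t - s)).toNNReal) P

/-- The Cramér–Lundberg claim model on `[0,T]`: a Poisson process `N` of intensity `lam > 0`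
counting the claims, and an i.i.d. sequence of positive claim sizes with distribution `F` and finite
second moment, independent of `N`. The size of the `(i+1)`-st claim is `Y i`. -/
structure ClaimModel {Ω : Type*} [MeasurableSpace Ω] (P : Measure Ω) where
  T : ℝ
  lam : ℝ
  F : Measure ℝ
  N : ℝ → Ω → ℕ
  Y : ℕ → Ω → ℝ
  T_pos : 0 < T
  lam_pos : 0 < lam
  poisson : IsPoissonProcess P T lam N
  Y_law : ∀ i, HasLaw (Y i) F P
  Y_pos : ∀ i, ∀ᵐ ω ∂P, 0 < Y i ω
  Y_indep : iIndepFun Y P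
  Y_sq : Integrable (fun y : ℝ => y ^ 2) F
  N_Y_indep : IndepFun (fun ω (t : Icc (0 : ℝ) T) => N t ω) (fun ω i => Y i ω) P

/-- The excess-of-loss coverage `l(t,y) = (y - d)_+` with deductible `d`. -/
noncomputable def excessOfLoss (d : ℝ) : ℝ → ℝ → ℝ :=
  fun _ y => max (y - d) 0

namespace ClaimModel

variable {Ω : Type*} [MeasurableSpace Ω] {P : Measure Ω} (M : ClaimModel P)

/-- The arrival time of the `(i+1)`-st claim (meaningful when `i < N T`). -/
noncomputable def arrival (i : ℕ) (ω : Ω) : ℝ :=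
  sInf {s | s ∈ Icc 0 M.T ∧ i < M.N s ω}

/-- The random measure `N(ds, dy)` on `[0,T] × (0,∞)`: a unit mass at (arrival time, size) of each
claim that arrives up to time `T`. -/
noncomputable def jumpMeasure (ω : Ω) : Measure (ℝ × ℝ) :=
  ∑ i ∈ Finset.range (M.N M.T ω), Measure.dirac (M.arrival i ω, M.Y i ω)

/-- The largest class of coverage functions `l : [0,T] × (0,∞) → ℝ` considered (extended to `ℝ × ℝ`
in any measurable way): nonnegative and square integrable with respect to `ds ⊗ dF`. -/
structure IsCoverage (l : ℝ → ℝ → ℝ) : Prop where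
  measurable : Measurable (Function.uncurry l)
  nonneg : ∀ t ∈ Icc 0 M.T, ∀ y > 0, 0 ≤ l t y
  sq_integrable : Integrable (fun z : ℝ × ℝ => l z.1 z.2 ^ 2)
    ((volume.restrict (Icc 0 M.T)).prod M.F)

/-- Coverage functions that pay at most the loss: `0 ≤ l(t,y) ≤ y`. -/
structure IsIndemnity (l : ℝ → ℝ → ℝ) : Prop where
  measurable : Measurable (Function.uncurry l)
  bounds : ∀ t ∈ Icc 0 M.T, ∀ y > 0, 0 ≤ l t y ∧ l t y ≤ y

/-- The premium rate at time `t` for coverage `l` under the expected-value principle with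
risk loading `xi`. -/
noncomputable def premiumRate (xi : ℝ) (l : ℝ → ℝ → ℝ) (t : ℝ) : ℝ :=
  (1 + xi) * M.lam * ∫ y in Ioi 0, l t y ∂M.F

/-- The customer's surplus at time `u` when it equals `x` at time `t ≤ u`: premiums are paid
continuously on `[t,u]`, and the retained parts `y - l(s,y)` of the claims in `(t,u]` are borne. -/
noncomputable def surplusFrom (xi : ℝ) (l : ℝ → ℝ → ℝ) (t x u : ℝ) (ω : Ω) : ℝ :=
  x - (∫ s in t..u, M.premiumRate xi l s)
    - ∫ z in Ioc t u ×ˢ Ioi 0, (z.2 - l z.1 z.2) ∂M.jumpMeasure ω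

/-- The customer's surplus process `X_C(t,l)` with initial surplus `xC`. -/
noncomputable def surplus (xi xC : ℝ) (l : ℝ → ℝ → ℝ) (t : ℝ) (ω : Ω) : ℝ :=
  M.surplusFrom xi l 0 xC t ω

/-- The mean–variance criterion `J(t,x,l)` of the terminal surplus, given surplus `x` at time `t`. -/
noncomputable def J (xi γ : ℝ) (t x : ℝ) (l : ℝ → ℝ → ℝ) : ℝ :=
  (∫ ω, M.surplusFrom xi l t x M.T ω ∂P)
    - γ / 2 * variance (M.surplusFrom xi l t x M.T) P

/-- The customer's objective `E[X_C(T,l)] - (γ/2) Var[X_C(T,l)]`. -/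
noncomputable def objective (xi γ xC : ℝ) (l : ℝ → ℝ → ℝ) : ℝ :=
  (∫ ω, M.surplus xi xC l M.T ω ∂P) - γ / 2 * variance (M.surplus xi xC l M.T) P

/-- The customer's value function: the supremum (in the extended reals) of the objective over the
admissible set `A`. -/
noncomputable def valueFunction (A : Set (ℝ → ℝ → ℝ)) (xi γ xC : ℝ) : EReal :=
  ⨆ l ∈ A, ((M.objective xi γ xC l : ℝ) : EReal)

/-- The strategy that uses `lbar` on `[t, t+ε)` and `l` elsewhere. -/
noncomputable def perturb (l : ℝ → ℝ → ℝ) (lbar : ℝ → ℝ) (t ε : ℝ) : ℝ → ℝ → ℝ :=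
  fun s y => if t ≤ s ∧ s < t + ε then lbar y else l s y

/-- `l` is an equilibrium strategy within the admissible set `A`: for every `(t,x)` and every
perturbation `lbar` whose perturbed strategies are admissible for all small `ε > 0`,
`liminf_{ε → 0+} (J(t,x,l) - J(t,x,l^ε)) / ε ≥ 0` (a limes inferior in the extended reals). -/
def IsEquilibrium (A : Set (ℝ → ℝ → ℝ)) (xi γ : ℝ) (l : ℝ → ℝ → ℝ) : Prop :=
  l ∈ A ∧ ∀ t ∈ Icc 0 M.T, ∀ x : ℝ, ∀ lbar : ℝ → ℝ,
    (∀ᶠ ε in 𝓝[>] (0 : ℝ), perturb l lbar t ε ∈ A) →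
    0 ≤ liminf (fun ε : ℝ =>
      (((M.J xi γ t x l - M.J xi γ t x (perturb l lbar t ε)) / ε : ℝ) : EReal)) (𝓝[>] 0)

/-- The flow property: after time `t` the surplus process is the surplus restarted at time `t` from
its value there. This justifies `J` as the criterion conditioned on the surplus at time `t`. -/
theorem surplus_flow (xi xC : ℝ) (l : ℝ → ℝ → ℝ) (hl : Measurable (Function.uncurry l))
    {t u : ℝ} (ht : 0 ≤ t) (htu : t ≤ u)
    (h1 : IntervalIntegrable (M.premiumRate xi l) volume 0 t)
    (h2 : IntervalIntegrable (M.premiumRate xi l) volume t u) (ω : Ω) :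
    M.surplus xi xC l u ω = M.surplusFrom xi l t (M.surplus xi xC l t ω) u ω := by
  have hm : Measurable fun z : ℝ × ℝ => z.2 - l z.1 z.2 := measurable_snd.sub hl
  have hi : Integrable (fun z : ℝ × ℝ => z.2 - l z.1 z.2) (M.jumpMeasure ω) := by
    unfold jumpMeasure
    rw [integrable_finsetSum_measure]
    intro i _
    exact integrable_dirac (by simp)
  have hset : Ioc 0 u ×ˢ Ioi (0 : ℝ) = (Ioc 0 t ×ˢ Ioi (0 : ℝ)) ∪ (Ioc t u ×ˢ Ioi (0 : ℝ)) := by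
    rw [← union_prod, Ioc_union_Ioc_eq_Ioc ht htu]
  have hdisj : Disjoint (Ioc 0 t ×ˢ Ioi (0 : ℝ)) (Ioc t u ×ˢ Ioi (0 : ℝ)) :=
    Disjoint.set_prod_left (by simp) _ _
  unfold surplus surplusFrom
  rw [hset, setIntegral_union hdisj (measurableSet_Ioc.prod measurableSet_Ioi)
    hi.integrableOn hi.integrableOn, ← intervalIntegral.integral_add_adjacent_intervals h1 h2]
  ring

end ClaimModel

/-! The claims form a marked Poisson process with intensity `λ ds ⊗ dF`. By Campbell's formulas, the
sum of a square integrable function over its points has mean `λ ∫ g` and variance `λ ∫ g²`. Applied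
to the retained loss, they give `J = x - λ ∫ cost` over `(t,T] × (0,∞)` (`J_eq`), where `cost = y +
ξ l + (γ/2)(y - l)²`. The variance of the terminal surplus is thus additive over time and claim
size, and the optimisation decouples into a pointwise one. For each `y` the cost is a convex
quadratic in `l ≥ 0`, minimised by `(y - ξ/γ)₊` (`cost_excessOfLoss_le`).

The same strategy is therefore optimal from every starting time, so the equilibrium property follows
from plain optimality: every difference quotient is nonnegative before any limit is taken.

Most of the work is Campbell's formulas (`moments_sum_marked`). They need only the first two moments
of the counts: `E[N_s]` and `E[N_s N_t]` fix the intensity and the second-moment structure of the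
arrival times (`HasPoissonMoments`), and the i.i.d. marks are integrated out with the path of `N`
frozen. -/

/-! ### First two moments of the Poisson distribution. -/

section PoissonMoments

open scoped ENNReal

/-- The Stein–Chen identity of the Poisson distribution. -/
lemma lintegral_natCast_mul_poissonMeasure (r : NNReal) (f : ℕ → ℝ≥0∞) :
    ∫⁻ n, (n : ℝ≥0∞) * f n ∂poissonMeasure r = r * ∫⁻ n, f (n + 1) ∂poissonMeasure r := by
  rw [lintegral_countable', lintegral_countable', tsum_eq_zero_add' ENNReal.summable,
    ← ENNReal.tsum_mul_left]
  simp only [Nat.cast_zero, zero_mul, zero_add]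
  refine tsum_congr fun n => ?_
  rw [poissonMeasure_singleton, poissonMeasure_singleton]
  have h : ENNReal.ofReal (Real.exp (-r) * r ^ (n + 1) / (n + 1).factorial) * ((n + 1 : ℕ) : ℝ≥0∞)
      = r * ENNReal.ofReal (Real.exp (-r) * r ^ n / n.factorial) := by
    rw [← ENNReal.ofReal_natCast, ← ENNReal.ofReal_coe_nnreal (p := r),
      ← ENNReal.ofReal_mul (by positivity), ← ENNReal.ofReal_mul (by positivity)]
    congr 1
    rw [Nat.factorial_succ]
    push_cast
    field_simp
    ring
  calc _ = (ENNReal.ofReal (Real.exp (-r) * r ^ (n + 1) / (n + 1).factorial)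
        * ((n + 1 : ℕ) : ℝ≥0∞)) * f (n + 1) := by ring
    _ = _ := by rw [h]; ring

lemma lintegral_natCast_poissonMeasure (r : NNReal) :
    ∫⁻ n, (n : ℝ≥0∞) ∂poissonMeasure r = r := by
  simpa using lintegral_natCast_mul_poissonMeasure r 1

lemma lintegral_natCast_sq_poissonMeasure (r : NNReal) :
    ∫⁻ n, (n : ℝ≥0∞) * n ∂poissonMeasure r = r * (r + 1) := by
  rw [lintegral_natCast_mul_poissonMeasure r fun n => (n : ℝ≥0∞)]
  simp only [Nat.cast_add, Nat.cast_one]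
  rw [lintegral_add_right _ measurable_const, lintegral_natCast_poissonMeasure]
  simp

end PoissonMoments

/-! ### Campbell's formulas for functions with values in `[0,∞]`. -/

section RandomSums

open scoped ENNReal

variable {Ω α β : Type*} [MeasurableSpace Ω] [MeasurableSpace α] [MeasurableSpace β]
  {P : Measure Ω}

lemma Measurable.sum_range_comp {E : Type*} [MeasurableSpace E] [AddCommMonoid E]
    [MeasurableAdd₂ E] {n : Ω → ℕ} {f : ℕ → Ω → E} (hn : Measurable n)
    (hf : ∀ i, Measurable (f i)) :
    Measurable fun ω => ∑ i ∈ Finset.range (n ω), f i ω := by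
  have h : Measurable fun p : ℕ × Ω => ∑ i ∈ Finset.range p.1, f i p.2 :=
    measurable_from_prod_countable_right fun m =>
      (Finset.measurable_fun_sum (f := f) (Finset.range m) fun i _ => hf i :)
  exact h.comp (hn.prodMk measurable_id)

/-- Campbell's formula for a weighted point process on the line, from its values on the sets
`Iic t`. -/
lemma lintegral_mul_sum_range_of_Iic [IsFiniteMeasure P] {n : Ω → ℕ} {a : ℕ → Ω → ℝ}
    {w : Ω → ℝ≥0∞}
    (hn : Measurable n) (ha : ∀ i, Measurable (a i)) (hw : AEMeasurable w P)
    (ρ : Measure ℝ) [IsFiniteMeasure ρ]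
    (hρ : ∀ t, ∫⁻ ω, w ω * (∑ i ∈ Finset.range (n ω), (Iic t).indicator 1 (a i ω)) ∂P = ρ (Iic t))
    {ψ : ℝ → ℝ≥0∞} (hψ : Measurable ψ) :
    ∫⁻ ω, w ω * (∑ i ∈ Finset.range (n ω), ψ (a i ω)) ∂P = ∫⁻ s, ψ s ∂ρ := by
  -- Mixing the point masses `κ ω` with weight `w` gives a measure whose integrals are the left-hand
  -- side; a finite measure on the line is determined by its values on `Iic t`.
  let κ : Ω → Measure ℝ := fun ω => ∑ i ∈ Finset.range (n ω), Measure.dirac (a i ω)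
  have hκf : ∀ ω {f : ℝ → ℝ≥0∞}, Measurable f →
      ∫⁻ s, f s ∂κ ω = ∑ i ∈ Finset.range (n ω), f (a i ω) := by
    intro ω f hf
    simp only [κ, lintegral_finsetSum_measure, lintegral_dirac' _ hf]
  have hκ : Measurable κ := by
    refine Measure.measurable_of_measurable_coe _ fun s hs => ?_
    have : (fun ω => κ ω s) = fun ω => ∑ i ∈ Finset.range (n ω), s.indicator 1 (a i ω) := by
      ext ω
      rw [← lintegral_indicator_one hs, hκf ω (measurable_one.indicator hs)]
    rw [this]
    exact Measurable.sum_range_comp hn fun i => (measurable_one.indicator hs).comp (ha i)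
  have hκl : ∀ {f : ℝ → ℝ≥0∞}, Measurable f → Measurable fun ω => ∫⁻ s, f s ∂κ ω :=
    fun hf => (Measure.measurable_lintegral hf).comp hκ
  have key : ∀ {f : ℝ → ℝ≥0∞}, Measurable f → ∫⁻ s, f s ∂((P.withDensity w).bind κ)
      = ∫⁻ ω, w ω * (∑ i ∈ Finset.range (n ω), f (a i ω)) ∂P := by
    intro f hf
    rw [Measure.lintegral_bind hκ.aemeasurable hf.aemeasurable,
      lintegral_withDensity_eq_lintegral_mul₀ hw
        (hκl hf).aemeasurable]
    simp only [Pi.mul_apply, hκf _ hf]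
  have hIic : ∀ t, (P.withDensity w).bind κ (Iic t) = ρ (Iic t) := fun t => by
    rw [← lintegral_indicator_one measurableSet_Iic,
      key (measurable_one.indicator measurableSet_Iic), hρ]
  -- The weight `w` may be unbounded, so finiteness is read off from `ρ`: both total masses are
  -- limits of the same masses of `Iic t`.
  have hfin : IsFiniteMeasure ((P.withDensity w).bind κ) := by
    constructor
    rw [tendsto_nhds_unique (tendsto_measure_Iic_atTop _)
      ((tendsto_measure_Iic_atTop ρ).congr fun t => (hIic t).symm)]
    exact measure_lt_top ρ univ
  have heq : (P.withDensity w).bind κ = ρ := Measure.ext_of_Iic _ _ hIic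
  rw [← key hψ, heq]

/-- Fubini for the product law; it serves to freeze the claim times `W` while the marks are
averaged. -/
lemma lintegral_comp_prodMk_of_indepFun [IsFiniteMeasure P] {W : Ω → α} {Z : Ω → β}
    (hW : AEMeasurable W P) (hZ : AEMeasurable Z P) (h : IndepFun W Z P)
    {G : α × β → ℝ≥0∞} (hG : Measurable G) :
    ∫⁻ ω, G (W ω, Z ω) ∂P = ∫⁻ ω, ∫⁻ ω', G (W ω, Z ω') ∂P ∂P := by
  rw [← lintegral_map' (f := G) (g := fun ω => (W ω, Z ω)) hG.aemeasurable (hW.prodMk hZ),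
    (indepFun_iff_map_prod_eq_prod_map_map hW hZ).1 h, lintegral_prod _ hG.aemeasurable,
    lintegral_map' hG.lintegral_prod_right'.aemeasurable hW]
  refine lintegral_congr fun ω => ?_
  exact lintegral_map' (hG.comp measurable_prodMk_left).aemeasurable hZ

variable {W : Ω → α} {Y : ℕ → Ω → ℝ} {F : Measure ℝ} {n : α → ℕ} {a : ℕ → α → ℝ}
  {φ : ℝ × ℝ → ℝ≥0∞}

lemma lintegral_comp_mark (hY : ∀ i, HasLaw (Y i) F P) (hφ : Measurable φ) (i : ℕ) (s : ℝ) :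
    ∫⁻ ω, φ (s, Y i ω) ∂P = ∫⁻ y, φ (s, y) ∂F := by
  rw [← (hY i).map_eq]
  exact (lintegral_map' (hφ.comp measurable_prodMk_left).aemeasurable (hY i).aemeasurable).symm

lemma lintegral_sum_range_marked [IsFiniteMeasure P] (hW : Measurable W)
    (hY : ∀ i, HasLaw (Y i) F P)
    (hWY : IndepFun W (fun ω i => Y i ω) P) (hn : Measurable n) (ha : ∀ i, Measurable (a i))
    (hφ : Measurable φ) :
    ∫⁻ ω, ∑ i ∈ Finset.range (n (W ω)), φ (a i (W ω), Y i ω) ∂P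
      = ∫⁻ ω, ∑ i ∈ Finset.range (n (W ω)), ∫⁻ y, φ (a i (W ω), y) ∂F ∂P := by
  have hG : Measurable fun p : α × (ℕ → ℝ) =>
      ∑ i ∈ Finset.range (n p.1), φ (a i p.1, p.2 i) :=
    Measurable.sum_range_comp (hn.comp measurable_fst) fun i => hφ.comp (by fun_prop)
  rw [lintegral_comp_prodMk_of_indepFun hW.aemeasurable
    (aemeasurable_pi_lambda _ fun i => (hY i).aemeasurable) hWY hG]
  refine lintegral_congr fun ω => ?_
  have hm : ∀ i, AEMeasurable (fun ω' => φ (a i (W ω), Y i ω')) P := fun i =>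
    (hφ.comp measurable_prodMk_left).comp_aemeasurable (hY i).aemeasurable
  dsimp only
  rw [lintegral_finsetSum' _ fun i _ => hm i]
  exact Finset.sum_congr rfl fun i _ => lintegral_comp_mark hY hφ i _

/-- Given `W`, the variance of a sum of independent terms is the sum of the variances. The negative
terms stand on the other side because subtraction in `[0,∞]` is truncated. Off the diagonal the
expectations factor; only the diagonal terms differ. -/
lemma lintegral_sq_sum_range_marked [IsProbabilityMeasure P] [SFinite F] (hW : Measurable W)
    (hY : ∀ i, HasLaw (Y i) F P) (hYi : iIndepFun Y P)
    (hWY : IndepFun W (fun ω i => Y i ω) P) (hn : Measurable n) (ha : ∀ i, Measurable (a i))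
    (hφ : Measurable φ) :
    ∫⁻ ω, (∑ i ∈ Finset.range (n (W ω)), φ (a i (W ω), Y i ω)) ^ 2 ∂P
        + ∫⁻ ω, ∑ i ∈ Finset.range (n (W ω)), (∫⁻ y, φ (a i (W ω), y) ∂F) ^ 2 ∂P
      = ∫⁻ ω, ∑ i ∈ Finset.range (n (W ω)), ∫⁻ y, φ (a i (W ω), y) ^ 2 ∂F ∂P
        + ∫⁻ ω, (∑ i ∈ Finset.range (n (W ω)), ∫⁻ y, φ (a i (W ω), y) ∂F) ^ 2 ∂P := by
  have hG : Measurable fun p : α × (ℕ → ℝ) =>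
      (∑ i ∈ Finset.range (n p.1), φ (a i p.1, p.2 i)) ^ 2 :=
    (Measurable.sum_range_comp (hn.comp measurable_fst)
      fun i => hφ.comp (by fun_prop)).pow_const 2
  have hφb : Measurable fun ω =>
      ∑ i ∈ Finset.range (n (W ω)), (∫⁻ y, φ (a i (W ω), y) ∂F) ^ 2 :=
    Measurable.sum_range_comp (hn.comp hW) fun i =>
      (hφ.lintegral_prod_right'.comp ((ha i).comp hW)).pow_const 2
  have hφb2 : Measurable fun ω =>
      ∑ i ∈ Finset.range (n (W ω)), ∫⁻ y, φ (a i (W ω), y) ^ 2 ∂F :=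
    Measurable.sum_range_comp (hn.comp hW) fun i =>
      (hφ.pow_const 2).lintegral_prod_right'.comp ((ha i).comp hW)
  rw [lintegral_comp_prodMk_of_indepFun hW.aemeasurable
    (aemeasurable_pi_lambda _ fun i => (hY i).aemeasurable) hWY hG,
    ← lintegral_add_right _ hφb, ← lintegral_add_left hφb2]
  refine lintegral_congr fun ω => ?_
  have hm : ∀ i, AEMeasurable (fun ω' => φ (a i (W ω), Y i ω')) P := fun i =>
    (hφ.comp measurable_prodMk_left).comp_aemeasurable (hY i).aemeasurable
  have hpair : ∀ i j, i ≠ j → ∫⁻ ω', φ (a i (W ω), Y i ω') * φ (a j (W ω), Y j ω') ∂P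
      = (∫⁻ y, φ (a i (W ω), y) ∂F) * ∫⁻ y, φ (a j (W ω), y) ∂F := by
    intro i j hij
    rw [lintegral_mul_eq_lintegral_mul_lintegral_of_indepFun'' (hm i) (hm j)
      ((hYi.indepFun hij).comp (φ := fun y => φ (a i (W ω), y)) (ψ := fun y => φ (a j (W ω), y))
        (hφ.comp measurable_prodMk_left)
        (hφ.comp measurable_prodMk_left)),
      lintegral_comp_mark hY hφ, lintegral_comp_mark hY hφ]
  have hdiag : ∀ i, ∫⁻ ω', φ (a i (W ω), Y i ω') * φ (a i (W ω), Y i ω') ∂P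
      = ∫⁻ y, φ (a i (W ω), y) ^ 2 ∂F := by
    intro i
    simp only [← sq]
    exact lintegral_comp_mark hY (hφ.pow_const 2) i _
  have hmm : ∀ i j, AEMeasurable
      (fun ω' => φ (a i (W ω), Y i ω') * φ (a j (W ω), Y j ω')) P := fun i j => (hm i).mul (hm j)
  simp only [sq (Finset.sum _ _), Finset.sum_mul_sum]
  rw [lintegral_finsetSum' _ fun i _ => Finset.aemeasurable_fun_sum _ fun j _ => hmm i j,
    ← Finset.sum_add_distrib, ← Finset.sum_add_distrib]
  refine Finset.sum_congr rfl fun i hi => ?_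
  rw [lintegral_finsetSum' _ fun j _ => hmm i j, ← Finset.add_sum_erase _ _ hi,
    ← Finset.add_sum_erase (Finset.range _)
      (fun j => (∫⁻ y, φ (a i (W ω), y) ∂F) * ∫⁻ y, φ (a j (W ω), y) ∂F) hi, hdiag,
    Finset.sum_congr rfl fun j hj => hpair i j (Finset.ne_of_mem_erase hj).symm]
  ring

/-- The points `a 0, …, a (n - 1)` have intensity `ν`, and their counts have the second moments of
a Poisson process. -/
structure HasPoissonMoments (P : Measure Ω) (ν : Measure ℝ) (n : Ω → ℕ) (a : ℕ → Ω → ℝ) : Prop where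
  measurable_card : Measurable n
  measurable_point : ∀ i, Measurable (a i)
  mean : ∀ t, ∫⁻ ω, ∑ i ∈ Finset.range (n ω), (Iic t).indicator 1 (a i ω) ∂P = ν (Iic t)
  mean_mul : ∀ s t, ∫⁻ ω, (∑ i ∈ Finset.range (n ω), (Iic s).indicator 1 (a i ω))
      * (∑ i ∈ Finset.range (n ω), (Iic t).indicator 1 (a i ω)) ∂P
    = ν (Iic s) * ν (Iic t) + ν (Iic (min s t))

namespace HasPoissonMoments

variable {ν : Measure ℝ} {n : Ω → ℕ} {a : ℕ → Ω → ℝ}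

lemma measurable_sum (h : HasPoissonMoments P ν n a) {f : ℝ → ℝ≥0∞} (hf : Measurable f) :
    Measurable fun ω => ∑ i ∈ Finset.range (n ω), f (a i ω) :=
  Measurable.sum_range_comp h.measurable_card fun i => hf.comp (h.measurable_point i)

lemma lintegral_sum [IsFiniteMeasure P] [IsFiniteMeasure ν] (h : HasPoissonMoments P ν n a)
    {f : ℝ → ℝ≥0∞} (hf : Measurable f) :
    ∫⁻ ω, ∑ i ∈ Finset.range (n ω), f (a i ω) ∂P = ∫⁻ s, f s ∂ν := by
  simpa using lintegral_mul_sum_range_of_Iic h.measurable_card h.measurable_point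
    (aemeasurable_const (b := (1 : ℝ≥0∞))) ν (fun t => by simpa using h.mean t) hf

/-- Both sides are linear in each of `f` and `g`. The weighted Campbell formula extends the identity
one factor at a time, the other factor playing the role of the weight: from indicators to `f`, then
to `g`. -/
lemma lintegral_sum_mul_sum [IsFiniteMeasure P] [IsFiniteMeasure ν]
    (h : HasPoissonMoments P ν n a) {f g : ℝ → ℝ≥0∞} (hf : Measurable f) (hg : Measurable g)
    (hfi : ∫⁻ s, f s ∂ν ≠ ∞) :
    ∫⁻ ω, (∑ i ∈ Finset.range (n ω), f (a i ω)) * (∑ i ∈ Finset.range (n ω), g (a i ω)) ∂P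
      = (∫⁻ s, f s ∂ν) * (∫⁻ s, g s ∂ν) + ∫⁻ s, f s * g s ∂ν := by
  have h1 : ∀ t, Measurable ((Iic t).indicator (1 : ℝ → ℝ≥0∞)) := fun t =>
    measurable_one.indicator measurableSet_Iic
  have step : ∀ t, ∫⁻ ω, (∑ i ∈ Finset.range (n ω), (Iic t).indicator 1 (a i ω))
      * (∑ i ∈ Finset.range (n ω), f (a i ω)) ∂P
      = ν (Iic t) * (∫⁻ s, f s ∂ν) + ∫⁻ s in Iic t, f s ∂ν := by
    intro t
    have : IsFiniteMeasure (ν (Iic t) • ν) := ν.smul_finite (measure_ne_top _ _)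
    rw [lintegral_mul_sum_range_of_Iic h.measurable_card h.measurable_point
      (h.measurable_sum (h1 t)).aemeasurable (ν (Iic t) • ν + ν.restrict (Iic t)) _ hf,
      lintegral_add_measure, lintegral_smul_measure, smul_eq_mul]
    intro s
    rw [h.mean_mul]
    simp [Measure.restrict_apply, Iic_inter_Iic, min_comm]
  have : IsFiniteMeasure ((∫⁻ s, f s ∂ν) • ν) := ν.smul_finite hfi
  have : IsFiniteMeasure (ν.withDensity f) := isFiniteMeasure_withDensity hfi
  rw [lintegral_mul_sum_range_of_Iic h.measurable_card h.measurable_point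
      (h.measurable_sum hf).aemeasurable ((∫⁻ s, f s ∂ν) • ν + ν.withDensity f) _ hg,
      lintegral_add_measure, lintegral_smul_measure, smul_eq_mul,
      lintegral_withDensity_eq_lintegral_mul _ hf hg]
  · rfl
  · intro t
    simp only [mul_comm (∑ i ∈ Finset.range _, f _)]
    rw [step, Measure.add_apply, withDensity_apply _ measurableSet_Iic]
    simp [mul_comm]

end HasPoissonMoments

lemma sq_lintegral_le_lintegral_sq {F : Measure α} [IsProbabilityMeasure F] {f : α → ℝ≥0∞}
    (hf : Measurable f) : (∫⁻ y, f y ∂F) ^ 2 ≤ ∫⁻ y, f y ^ 2 ∂F := by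
  have h := ENNReal.lintegral_mul_le_Lp_mul_Lq F (Real.HolderConjugate.two_two)
    hf.aemeasurable (aemeasurable_const (b := (1 : ℝ≥0∞)))
  simp only [Pi.mul_apply, mul_one, ENNReal.one_rpow, lintegral_one, measure_univ] at h
  calc _ ≤ ((∫⁻ y, f y ^ (2 : ℝ) ∂F) ^ (1 / 2 : ℝ)) ^ 2 := by gcongr
    _ = _ := by
      rw [← ENNReal.rpow_natCast, ← ENNReal.rpow_mul]
      norm_num

section Marked

variable {W : Ω → α} {Y : ℕ → Ω → ℝ} {F : Measure ℝ} {n : α → ℕ} {a : ℕ → α → ℝ}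
  {ν : Measure ℝ} {φ : ℝ × ℝ → ℝ≥0∞}

/-- Campbell's formula for the mean of a marked point process. -/
lemma lintegral_sum_marked [IsProbabilityMeasure P] [IsFiniteMeasure ν] [SFinite F]
    (hW : Measurable W) (hY : ∀ i, HasLaw (Y i) F P)
    (hWY : IndepFun W (fun ω i => Y i ω) P) (hn : Measurable n) (ha : ∀ i, Measurable (a i))
    (h : HasPoissonMoments P ν (fun ω => n (W ω)) fun i ω => a i (W ω)) (hφ : Measurable φ) :
    ∫⁻ ω, ∑ i ∈ Finset.range (n (W ω)), φ (a i (W ω), Y i ω) ∂P = ∫⁻ z, φ z ∂(ν.prod F) := by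
  rw [lintegral_sum_range_marked hW hY hWY hn ha hφ,
    h.lintegral_sum hφ.lintegral_prod_right', lintegral_prod _ hφ.aemeasurable]

/-- Campbell's formula for the second moment of a marked point process. -/
lemma lintegral_sq_sum_marked [IsProbabilityMeasure P] [IsFiniteMeasure ν] [IsProbabilityMeasure F]
    (hW : Measurable W) (hY : ∀ i, HasLaw (Y i) F P) (hYi : iIndepFun Y P)
    (hWY : IndepFun W (fun ω i => Y i ω) P) (hn : Measurable n) (ha : ∀ i, Measurable (a i))
    (h : HasPoissonMoments P ν (fun ω => n (W ω)) fun i ω => a i (W ω)) (hφ : Measurable φ)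
    (hφ2 : ∫⁻ z, φ z ^ 2 ∂(ν.prod F) ≠ ∞) :
    ∫⁻ ω, (∑ i ∈ Finset.range (n (W ω)), φ (a i (W ω), Y i ω)) ^ 2 ∂P
      = ∫⁻ z, φ z ^ 2 ∂(ν.prod F) + (∫⁻ z, φ z ∂(ν.prod F)) ^ 2 := by
  have hb : Measurable fun s => ∫⁻ y, φ (s, y) ∂F := hφ.lintegral_prod_right'
  have hb2 : Measurable fun s => ∫⁻ y, φ (s, y) ^ 2 ∂F := (hφ.pow_const 2).lintegral_prod_right'
  -- This term occurs on both sides of `key` below; its finiteness lets it be cancelled.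
  have hsq : ∫⁻ s, (∫⁻ y, φ (s, y) ∂F) ^ 2 ∂ν ≠ ∞ := by
    refine ne_top_of_le_ne_top hφ2 ?_
    rw [lintegral_prod _ (hφ.pow_const 2).aemeasurable]
    exact lintegral_mono fun s => sq_lintegral_le_lintegral_sq (hφ.comp measurable_prodMk_left)
  -- From square integrability, by `b ≤ 1 + b²` and the finiteness of `ν`.
  have h1 : ∫⁻ s, ∫⁻ y, φ (s, y) ∂F ∂ν ≠ ∞ := by
    refine ne_top_of_le_ne_top (b := ∫⁻ s, (1 + (∫⁻ y, φ (s, y) ∂F) ^ 2) ∂ν) ?_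
      (lintegral_mono fun s => ?_)
    · rw [lintegral_add_left measurable_const]
      simp [hsq, measure_ne_top]
    · rcases le_total (∫⁻ y, φ (s, y) ∂F) 1 with h1 | h1
      · exact h1.trans le_self_add
      · exact (le_self_pow h1 two_ne_zero).trans le_add_self
  have key := lintegral_sq_sum_range_marked hW hY hYi hWY hn ha hφ
  simp only [sq (Finset.sum (Finset.range _) fun i => ∫⁻ y, φ (_, y) ∂F)] at key
  rw [h.lintegral_sum (hb.pow_const 2), h.lintegral_sum hb2, h.lintegral_sum_mul_sum hb hb h1,
    ← lintegral_prod _ hφ.aemeasurable, 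
    ← lintegral_prod (fun z => φ z ^ 2) (hφ.pow_const 2).aemeasurable, ← add_assoc] at key
  simp only [← sq] at key
  exact (ENNReal.add_left_inj hsq).1 key

end Marked

end RandomSums

/-! ### Campbell's formulas for real square integrable functions. -/

section MarkedReal

variable {Ω α : Type*} [MeasurableSpace Ω] [MeasurableSpace α] {P : Measure Ω}
  {W : Ω → α} {Y : ℕ → Ω → ℝ} {F : Measure ℝ} {n : α → ℕ} {a : ℕ → α → ℝ}
  {ν : Measure ℝ} {g : ℝ × ℝ → ℝ}

lemma aemeasurable_sum_marked (hW : Measurable W) (hY : ∀ i, HasLaw (Y i) F P)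
    (hn : Measurable n) (ha : ∀ i, Measurable (a i)) (hg : Measurable g) :
    AEMeasurable (fun ω => ∑ i ∈ Finset.range (n (W ω)), g (a i (W ω), Y i ω)) P := by
  have hG : Measurable fun p : α × (ℕ → ℝ) =>
      ∑ i ∈ Finset.range (n p.1), g (a i p.1, p.2 i) :=
    Measurable.sum_range_comp (hn.comp measurable_fst) fun i => hg.comp (by fun_prop)
  exact hG.comp_aemeasurable (hW.aemeasurable.prodMk
    (aemeasurable_pi_lambda _ fun i => (hY i).aemeasurable))

lemma moments_sum_marked_of_nonneg [IsProbabilityMeasure P] [IsFiniteMeasure ν]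
    [IsProbabilityMeasure F] (hW : Measurable W) (hY : ∀ i, HasLaw (Y i) F P)
    (hYi : iIndepFun Y P) (hWY : IndepFun W (fun ω i => Y i ω) P) (hn : Measurable n)
    (ha : ∀ i, Measurable (a i))
    (h : HasPoissonMoments P ν (fun ω => n (W ω)) fun i ω => a i (W ω)) (hg : Measurable g)
    (hg2 : MemLp g 2 (ν.prod F)) (hg0 : ∀ z, 0 ≤ g z) :
    MemLp (fun ω => ∑ i ∈ Finset.range (n (W ω)), g (a i (W ω), Y i ω)) 2 P ∧
    ∫ ω, ∑ i ∈ Finset.range (n (W ω)), g (a i (W ω), Y i ω) ∂P = ∫ z, g z ∂(ν.prod F) ∧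
    ∫ ω, (∑ i ∈ Finset.range (n (W ω)), g (a i (W ω), Y i ω)) ^ 2 ∂P
      = ∫ z, g z ^ 2 ∂(ν.prod F) + (∫ z, g z ∂(ν.prod F)) ^ 2 := by
  have hS := (aemeasurable_sum_marked hW hY hn ha hg).aestronglyMeasurable
  have hS0 : ∀ ω, 0 ≤ ∑ i ∈ Finset.range (n (W ω)), g (a i (W ω), Y i ω) := fun ω =>
    Finset.sum_nonneg fun i _ => hg0 _
  have hof : ∀ ω, ENNReal.ofReal (∑ i ∈ Finset.range (n (W ω)), g (a i (W ω), Y i ω))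
      = ∑ i ∈ Finset.range (n (W ω)), ENNReal.ofReal (g (a i (W ω), Y i ω)) := fun ω =>
    ENNReal.ofReal_sum_of_nonneg fun i _ => hg0 _
  have hgi : Integrable g (ν.prod F) := hg2.integrable (by norm_num)
  have hgi2 : Integrable (fun z => g z ^ 2) (ν.prod F) := hg2.integrable_sq
  have e1 : ∫⁻ z, ENNReal.ofReal (g z) ∂(ν.prod F) = ENNReal.ofReal (∫ z, g z ∂(ν.prod F)) :=
    (ofReal_integral_eq_lintegral_ofReal hgi (ae_of_all _ hg0)).symm
  have e2 : ∫⁻ z, ENNReal.ofReal (g z) ^ 2 ∂(ν.prod F)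
      = ENNReal.ofReal (∫ z, g z ^ 2 ∂(ν.prod F)) := by
    rw [ofReal_integral_eq_lintegral_ofReal hgi2 (ae_of_all _ fun z => sq_nonneg _)]
    exact lintegral_congr fun z => (ENNReal.ofReal_pow (hg0 z) 2).symm
  have m1 := lintegral_sum_marked hW hY hWY hn ha h hg.ennreal_ofReal
  have m2 := lintegral_sq_sum_marked hW hY hYi hWY hn ha h hg.ennreal_ofReal
    (by rw [e2]; exact ENNReal.ofReal_ne_top)
  have i1 : 0 ≤ ∫ z, g z ∂(ν.prod F) := integral_nonneg hg0
  have i2 : 0 ≤ ∫ z, g z ^ 2 ∂(ν.prod F) := integral_nonneg fun z => sq_nonneg _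
  simp only [← hof] at m1 m2
  rw [e1] at m1
  rw [e1, e2, ← ENNReal.ofReal_pow i1, ← ENNReal.ofReal_add i2 (sq_nonneg _)] at m2
  simp only [← ENNReal.ofReal_pow (hS0 _)] at m2
  refine ⟨(memLp_two_iff_integrable_sq hS).2 ⟨hS.pow 2, ?_⟩, ?_, ?_⟩
  · rw [hasFiniteIntegral_iff_ofReal (ae_of_all _ fun ω => sq_nonneg _), m2]
    exact ENNReal.ofReal_lt_top
  · rw [integral_eq_lintegral_of_nonneg_ae (ae_of_all _ hS0) hS, m1, ENNReal.toReal_ofReal i1]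
  · rw [integral_eq_lintegral_of_nonneg_ae (ae_of_all _ fun ω => sq_nonneg _) (hS.pow 2), m2,
      ENNReal.toReal_ofReal (by positivity)]

/-- Campbell's formulas: a square integrable function, summed over the points of a marked point
process with the moments of a Poisson process. -/
lemma moments_sum_marked [IsProbabilityMeasure P] [IsFiniteMeasure ν]
    [IsProbabilityMeasure F] (hW : Measurable W) (hY : ∀ i, HasLaw (Y i) F P)
    (hYi : iIndepFun Y P) (hWY : IndepFun W (fun ω i => Y i ω) P) (hn : Measurable n)
    (ha : ∀ i, Measurable (a i))
    (h : HasPoissonMoments P ν (fun ω => n (W ω)) fun i ω => a i (W ω)) (hg : Measurable g)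
    (hg2 : MemLp g 2 (ν.prod F)) :
    MemLp (fun ω => ∑ i ∈ Finset.range (n (W ω)), g (a i (W ω), Y i ω)) 2 P ∧
    ∫ ω, ∑ i ∈ Finset.range (n (W ω)), g (a i (W ω), Y i ω) ∂P = ∫ z, g z ∂(ν.prod F) ∧
    Var[fun ω => ∑ i ∈ Finset.range (n (W ω)), g (a i (W ω), Y i ω); P]
      = ∫ z, g z ^ 2 ∂(ν.prod F) := by
  have key := fun (f : ℝ × ℝ → ℝ) (hf : Measurable f) hf2 hf0 =>
    moments_sum_marked_of_nonneg (g := f) hW hY hYi hWY hn ha h hf hf2 hf0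
  have hp2 : MemLp (fun z => max (g z) 0) 2 (ν.prod F) := hg2.pos_part
  have hm2 : MemLp (fun z => max (-g z) 0) 2 (ν.prod F) := hg2.neg_part
  have ha2 : MemLp (fun z => |g z|) 2 (ν.prod F) := hg2.abs
  obtain ⟨p1, p2, p3⟩ := key (fun z => max (g z) 0) (hg.max measurable_const) hp2
    fun z => le_max_right _ _
  obtain ⟨m1, m2, m3⟩ := key (fun z => max (-g z) 0) (hg.neg.max measurable_const) hm2
    fun z => le_max_right _ _
  obtain ⟨a1, a2, a3⟩ := key (fun z => |g z|) hg.abs ha2 fun z => abs_nonneg _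
  have dec : ∀ z, g z = max (g z) 0 - max (-g z) 0 := fun z => by
    rcases le_total (g z) 0 with hz | hz
    · simp [hz]
    · simp [hz]
  have dabs : ∀ z, |g z| = max (g z) 0 + max (-g z) 0 := fun z => by
    rcases le_total (g z) 0 with hz | hz
    · simp [hz, abs_of_nonpos hz]
    · simp [hz]
  have hSdec : ∀ ω, ∑ i ∈ Finset.range (n (W ω)), g (a i (W ω), Y i ω)
      = ∑ i ∈ Finset.range (n (W ω)), max (g (a i (W ω), Y i ω)) 0
        - ∑ i ∈ Finset.range (n (W ω)), max (-g (a i (W ω), Y i ω)) 0 := fun ω => by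
    rw [← Finset.sum_sub_distrib]
    exact Finset.sum_congr rfl fun i _ => dec _
  have hSabs : ∀ ω, ∑ i ∈ Finset.range (n (W ω)), |g (a i (W ω), Y i ω)|
      = ∑ i ∈ Finset.range (n (W ω)), max (g (a i (W ω), Y i ω)) 0
        + ∑ i ∈ Finset.range (n (W ω)), max (-g (a i (W ω), Y i ω)) 0 := fun ω => by
    rw [← Finset.sum_add_distrib]
    exact Finset.sum_congr rfl fun i _ => dabs _
  have hS2 : MemLp (fun ω => ∑ i ∈ Finset.range (n (W ω)), g (a i (W ω), Y i ω)) 2 P := by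
    simp only [hSdec]
    exact p1.sub m1
  have hmean : ∫ z, g z ∂(ν.prod F)
      = ∫ z, max (g z) 0 ∂(ν.prod F) - ∫ z, max (-g z) 0 ∂(ν.prod F) := by
    rw [← integral_sub (hp2.integrable (by norm_num)) (hm2.integrable (by norm_num))]
    exact integral_congr_ae (ae_of_all _ dec)
  have hamean : ∫ z, |g z| ∂(ν.prod F)
      = ∫ z, max (g z) 0 ∂(ν.prod F) + ∫ z, max (-g z) 0 ∂(ν.prod F) := by
    rw [← integral_add (hp2.integrable (by norm_num)) (hm2.integrable (by norm_num))]
    exact integral_congr_ae (ae_of_all _ dabs)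
  have hsq : ∫ z, g z ^ 2 ∂(ν.prod F)
      = ∫ z, max (g z) 0 ^ 2 ∂(ν.prod F) + ∫ z, max (-g z) 0 ^ 2 ∂(ν.prod F) := by
    rw [← integral_add hp2.integrable_sq hm2.integrable_sq]
    refine integral_congr_ae (ae_of_all _ fun z => ?_)
    rcases le_total (g z) 0 with hz | hz
    · simp [hz]
    · simp [hz]
  have hmS : ∫ ω, ∑ i ∈ Finset.range (n (W ω)), g (a i (W ω), Y i ω) ∂P
      = ∫ z, g z ∂(ν.prod F) := by
    simp only [hSdec]
    rw [integral_sub (p1.integrable (by norm_num)) (m1.integrable (by norm_num)), p2, m2, hmean]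
  refine ⟨hS2, hmS, ?_⟩
  -- The parallelogram law `(p - m)² + (p + m)² = 2p² + 2m²` for the sums over the positive and
  -- negative parts. It yields the signed second moment from three nonnegative ones, with no cross
  -- term to compute.
  have hpar : ∫ ω, (∑ i ∈ Finset.range (n (W ω)), g (a i (W ω), Y i ω)) ^ 2 ∂P
      + ∫ ω, (∑ i ∈ Finset.range (n (W ω)), |g (a i (W ω), Y i ω)|) ^ 2 ∂P
      = 2 * ∫ ω, (∑ i ∈ Finset.range (n (W ω)), max (g (a i (W ω), Y i ω)) 0) ^ 2 ∂P
      + 2 * ∫ ω, (∑ i ∈ Finset.range (n (W ω)), max (-g (a i (W ω), Y i ω)) 0) ^ 2 ∂P := by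
    rw [← integral_add hS2.integrable_sq a1.integrable_sq, ← integral_const_mul,
      ← integral_const_mul, ← integral_add (p1.integrable_sq.const_mul 2)
        (m1.integrable_sq.const_mul 2)]
    refine integral_congr_ae (ae_of_all _ fun ω => ?_)
    simp only [hSdec, hSabs]
    ring
  rw [variance_eq_sub hS2, hmS]
  simp only [Pi.pow_apply]
  simp only [sq_abs] at a3
  rw [a3, p3, m3, hamean] at hpar
  rw [hmean]
  linarith [hpar, hsq, hmean]

end MarkedReal

/-! ### The arrival times of the claims and the moments of their counts. -/

namespace ClaimModel

open scoped ENNReal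

variable {Ω : Type*} [MeasurableSpace Ω] {P : Measure Ω} (M : ClaimModel P)

/-- The path of the counting process on `[0,T]`. -/
def path (ω : Ω) (t : Icc (0 : ℝ) M.T) : ℕ := M.N t ω

/-- The number of claims of a path up to time `T`. -/
def pathCard (w : Icc (0 : ℝ) M.T → ℕ) : ℕ := w ⟨M.T, M.T_pos.le, le_rfl⟩

/-- The arrival times as measurable functions of the path. -/
noncomputable def pathArrival (i : ℕ) (w : Icc (0 : ℝ) M.T → ℕ) : ℝ :=
  ⨅ q : ℚ, if h : (q : ℝ) ∈ Icc 0 M.T then (if i < w ⟨q, h⟩ then (q : ℝ) else M.T) else M.T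

lemma measurable_path : Measurable M.path :=
  measurable_pi_lambda _ fun t => M.poisson.measurable t t.2

lemma measurable_pathCard : Measurable M.pathCard := measurable_pi_apply _

lemma measurable_pathArrival (i : ℕ) : Measurable (M.pathArrival i) := by
  refine Measurable.iInf fun q => ?_
  by_cases h : (q : ℝ) ∈ Icc 0 M.T
  · simp only [h, dif_pos]
    exact Measurable.ite (measurableSet_lt measurable_const (measurable_pi_apply _))
      measurable_const measurable_const
  · simp only [h, dif_neg, not_false_eq_true]
    exact measurable_const

lemma T_mem : M.T ∈ Icc 0 M.T := ⟨M.T_pos.le, le_rfl⟩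

lemma arrival_mem {i : ℕ} {ω : Ω} (hi : i < M.N M.T ω) : M.arrival i ω ∈ Icc 0 M.T :=
  ⟨le_csInf ⟨M.T, M.T_mem, hi⟩ fun _ hs => hs.1.1,
    csInf_le ⟨0, fun _ hs => hs.1.1⟩ ⟨M.T_mem, hi⟩⟩

/-- Monotone paths make rational times sufficient: a time before `T` with more than `i` claims can
be moved right to a nearby rational. The countable infimum is measurable in the path, which is the
object independent of the claim sizes. -/
lemma arrival_eq_pathArrival {ω : Ω} (hmono : MonotoneOn (fun t => M.N t ω) (Icc 0 M.T)) {i : ℕ}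
    (hi : i < M.N M.T ω) : M.arrival i ω = M.pathArrival i (M.path ω) := by
  have hbdd : BddBelow {s | s ∈ Icc 0 M.T ∧ i < M.N s ω} := ⟨0, fun _ hs => hs.1.1⟩
  have hle : ∀ q : ℚ, M.arrival i ω ≤ if h : (q : ℝ) ∈ Icc 0 M.T then
      (if i < M.path ω ⟨q, h⟩ then (q : ℝ) else M.T) else M.T := by
    intro q
    split_ifs with h h'
    · exact csInf_le hbdd ⟨h, h'⟩
    · exact (M.arrival_mem hi).2
    · exact (M.arrival_mem hi).2
  refine le_antisymm (le_ciInf hle) ?_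
  have hbdd' : BddBelow (range fun q : ℚ => if h : (q : ℝ) ∈ Icc 0 M.T then
      (if i < M.path ω ⟨q, h⟩ then (q : ℝ) else M.T) else M.T) :=
    ⟨_, by rintro _ ⟨q, rfl⟩; exact hle q⟩
  refine le_of_forall_gt_imp_ge_of_dense fun b hb => ?_
  obtain ⟨s, ⟨hs, his⟩, hsb⟩ := exists_lt_of_csInf_lt
    (show {s | s ∈ Icc 0 M.T ∧ i < M.N s ω}.Nonempty from ⟨M.T, M.T_mem, hi⟩) hb
  -- `T` may be irrational, but it is the default value of the infimum, so any index, here `0`,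
  -- gives a term at most `T`.
  rcases hs.2.eq_or_lt with rfl | hsT
  · refine (ciInf_le hbdd' 0).trans (le_trans ?_ hsb.le)
    split_ifs <;> simp [hs.1]
  · obtain ⟨q, hq1, hq2⟩ := exists_rat_btwn (lt_min hsb hsT)
    have hq : (q : ℝ) ∈ Icc 0 M.T := ⟨hs.1.trans hq1.le, hq2.le.trans (min_le_right _ _)⟩
    have hiq : i < M.path ω ⟨q, hq⟩ := his.trans_le (hmono hs hq hq1.le)
    refine (ciInf_le hbdd' q).trans ?_
    rw [dif_pos hq, if_pos hiq]
    exact hq2.le.trans (min_le_left _ _)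

lemma arrival_le_iff {ω : Ω} (hmono : MonotoneOn (fun t => M.N t ω) (Icc 0 M.T))
    (hcont : ∀ t ∈ Ico 0 M.T, ContinuousWithinAt (fun s => M.N s ω) (Ici t) t) {i : ℕ}
    (hi : i < M.N M.T ω) {t : ℝ} (ht : t ∈ Icc 0 M.T) : M.arrival i ω ≤ t ↔ i < M.N t ω := by
  refine ⟨fun h => ?_, fun h => csInf_le ⟨0, fun _ hs => hs.1.1⟩ ⟨ht, h⟩⟩
  rcases ht.2.eq_or_lt with rfl | htT
  · exact hi
  -- A right-continuous path in the discrete space `ℕ` is constant just after `t`, so the infimum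
  -- cannot equal `t` without `i < N t`.
  have hev : ∀ᶠ s in 𝓝[>] t, M.N s ω = M.N t ω :=
    nhdsWithin_mono t Ioi_subset_Ici_self
      ((hcont t ⟨ht.1, htT⟩).eventually (p := fun k => k = M.N t ω) (by simp [nhds_discrete]))
  obtain ⟨s, hs, hts, hsT⟩ := (hev.and (Ioo_mem_nhdsGT htT)).exists
  obtain ⟨u, ⟨hu, hiu⟩, hus⟩ := exists_lt_of_csInf_lt
    (show {s | s ∈ Icc 0 M.T ∧ i < M.N s ω}.Nonempty from ⟨M.T, M.T_mem, hi⟩) (h.trans_lt hts)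
  rw [← hs]
  exact hiu.trans_le (hmono hu ⟨ht.1.trans hts.le, hsT.le⟩ hus.le)

/-- The nearest point of `[0,T]`. -/
noncomputable def clip (t : ℝ) : ℝ := max 0 (min t M.T)

lemma clip_mem (t : ℝ) : M.clip t ∈ Icc 0 M.T :=
  ⟨le_max_left _ _, max_le M.T_pos.le (min_le_right _ _)⟩

lemma clip_mono : Monotone M.clip := fun _ _ h => max_le_max le_rfl (min_le_min h le_rfl)

lemma sum_indicator_pathArrival {ω : Ω} (hzero : M.N 0 ω = 0)
    (hmono : MonotoneOn (fun t => M.N t ω) (Icc 0 M.T))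
    (hcont : ∀ t ∈ Ico 0 M.T, ContinuousWithinAt (fun s => M.N s ω) (Ici t) t) (t : ℝ) :
    ∑ i ∈ Finset.range (M.pathCard (M.path ω)),
      (Iic t).indicator (1 : ℝ → ℝ≥0∞) (M.pathArrival i (M.path ω)) = M.N (M.clip t) ω := by
  have hiff : ∀ i < M.N M.T ω, M.arrival i ω ≤ t ↔ i < M.N (M.clip t) ω := by
    intro i hi
    rw [← M.arrival_le_iff hmono hcont hi (M.clip_mem t)]
    -- Since `N 0 = 0`, no claim arrives at time `0`; this is what makes clipping a negative `t` to
    -- `0` harmless.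
    have hpos : ¬ M.arrival i ω ≤ 0 := by
      rw [M.arrival_le_iff hmono hcont hi ⟨le_rfl, M.T_pos.le⟩, hzero]
      simp
    have hT := (M.arrival_mem hi).2
    simp [clip, hpos, hT]
  have hle : M.N (M.clip t) ω ≤ M.N M.T ω := hmono (M.clip_mem t) M.T_mem (M.clip_mem t).2
  have : ∀ i ∈ Finset.range (M.N M.T ω), (Iic t).indicator (1 : ℝ → ℝ≥0∞)
      (M.pathArrival i (M.path ω)) = if i < M.N (M.clip t) ω then 1 else 0 := by
    intro i hi
    rw [Finset.mem_range] at hi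
    rw [← M.arrival_eq_pathArrival hmono hi]
    simp only [indicator_apply, mem_Iic, hiff i hi, Pi.one_apply]
  change ∑ i ∈ Finset.range (M.N M.T ω), _ = _
  rw [Finset.sum_congr rfl this, Finset.sum_ite, Finset.sum_const_zero, add_zero,
    Finset.sum_const, nsmul_one]
  congr 1
  refine Eq.trans (congrArg _ ?_) (Finset.card_range (M.N (M.clip t) ω))
  ext i
  simp only [Finset.mem_filter, Finset.mem_range]
  exact ⟨fun h => h.2, fun h => ⟨h.trans_le hle, h⟩⟩

lemma lintegral_increment {s t : ℝ} (hs : 0 ≤ s) (hst : s ≤ t) (ht : t ≤ M.T) :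
    ∫⁻ ω, ((M.N t ω - M.N s ω : ℕ) : ℝ≥0∞) ∂P = ENNReal.ofReal (M.lam * (t - s)) := by
  have h := M.poisson.law s t hs hst ht
  rw [← lintegral_map' (f := fun k : ℕ => (k : ℝ≥0∞)) Measurable.of_discrete.aemeasurable
    h.aemeasurable, h.map_eq, lintegral_natCast_poissonMeasure]
  rfl

lemma hasLaw_count {t : ℝ} (ht : t ∈ Icc 0 M.T) :
    HasLaw (M.N t) (poissonMeasure (M.lam * t).toNNReal) P := by
  have h := M.poisson.law 0 t le_rfl ht.1 ht.2
  rw [sub_zero] at h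
  refine h.congr ?_
  filter_upwards [M.poisson.zero] with ω hω
  simp [hω]

lemma lintegral_count {t : ℝ} (ht : t ∈ Icc 0 M.T) :
    ∫⁻ ω, (M.N t ω : ℝ≥0∞) ∂P = ENNReal.ofReal (M.lam * t) := by
  have h := M.hasLaw_count ht
  rw [← lintegral_map' (f := fun k : ℕ => (k : ℝ≥0∞)) Measurable.of_discrete.aemeasurable
    h.aemeasurable, h.map_eq, lintegral_natCast_poissonMeasure]
  rfl

/-- Write `N t = N s + (N t - N s)`: the increment is independent of `N s`, and `N s` has second
moment `λs(λs + 1)`. -/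
lemma lintegral_count_mul_count {s t : ℝ} (hs : s ∈ Icc 0 M.T) (ht : t ∈ Icc 0 M.T)
    (hst : s ≤ t) :
    ∫⁻ ω, (M.N s ω : ℝ≥0∞) * M.N t ω ∂P
      = ENNReal.ofReal (M.lam * s) * ENNReal.ofReal (M.lam * t) + ENNReal.ofReal (M.lam * s) := by
  have h := M.hasLaw_count hs
  have hsm := M.poisson.measurable s hs
  have htm := M.poisson.measurable t ht
  have hsq : ∫⁻ ω, (M.N s ω : ℝ≥0∞) * M.N s ω ∂P
      = ENNReal.ofReal (M.lam * s) * (ENNReal.ofReal (M.lam * s) + 1) := by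
    rw [← lintegral_map' (f := fun k : ℕ => (k : ℝ≥0∞) * k) Measurable.of_discrete.aemeasurable
      h.aemeasurable, h.map_eq, lintegral_natCast_sq_poissonMeasure]
    rfl
  have hind : IndepFun (M.N s) (fun ω => M.N t ω - M.N s ω) P := by
    have h0 := M.poisson.indepIncrements.indepFun_eval_sub (r := ⟨0, le_rfl, M.T_pos.le⟩)
      (s := ⟨s, hs⟩) (t := ⟨t, ht⟩) hs.1 hst
      (by filter_upwards [M.poisson.zero] with ω hω using by simp [hω])
    -- Independence is stated for integer increments; `Int.toNat` turns them into the truncated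
    -- differences of `ℕ`.
    refine (h0.comp (φ := Int.toNat) (ψ := Int.toNat) Measurable.of_discrete
      Measurable.of_discrete).congr ?_ ?_
    · exact ae_of_all _ fun ω => by simp
    · exact ae_of_all _ fun ω => by simp
  have hmul : ∫⁻ ω, (M.N s ω : ℝ≥0∞) * (M.N t ω - M.N s ω : ℕ) ∂P
      = ENNReal.ofReal (M.lam * s) * ENNReal.ofReal (M.lam * (t - s)) := by
    rw [← M.lintegral_count hs, ← M.lintegral_increment hs.1 hst ht.2]
    exact lintegral_mul_eq_lintegral_mul_lintegral_of_indepFun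
      (Measurable.of_discrete.comp hsm) (Measurable.of_discrete.comp (htm.sub hsm))
      (hind.comp (φ := fun k : ℕ => (k : ℝ≥0∞)) (ψ := fun k : ℕ => (k : ℝ≥0∞))
        Measurable.of_discrete Measurable.of_discrete)
  have hsplit : ∀ᵐ ω ∂P, (M.N s ω : ℝ≥0∞) * M.N t ω
      = (M.N s ω : ℝ≥0∞) * M.N s ω + (M.N s ω : ℝ≥0∞) * (M.N t ω - M.N s ω : ℕ) := by
    filter_upwards [M.poisson.mono] with ω hω
    rw [← mul_add, ← Nat.cast_add, Nat.add_sub_cancel' (hω hs ht hst)]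
  have hcast : Measurable fun ω => (M.N s ω : ℝ≥0∞) := Measurable.of_discrete.comp hsm
  rw [lintegral_congr_ae hsplit,
    lintegral_add_left (f := fun ω => (M.N s ω : ℝ≥0∞) * M.N s ω) (hcast.mul hcast), hsq, hmul, mul_add, mul_one,
    add_right_comm, ← mul_add, ← ENNReal.ofReal_add (mul_nonneg M.lam_pos.le hs.1)
      (mul_nonneg M.lam_pos.le (sub_nonneg.2 hst)), ← mul_add, add_sub_cancel]

/-- The intensity measure of the arrival times. -/
noncomputable def intensity : Measure ℝ :=
  ENNReal.ofReal M.lam • volume.restrict (Icc 0 M.T)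

instance : IsFiniteMeasure M.intensity :=
  Measure.smul_finite _ ENNReal.ofReal_ne_top

lemma intensity_Iic (t : ℝ) : M.intensity (Iic t) = ENNReal.ofReal (M.lam * M.clip t) := by
  rw [intensity, Measure.smul_apply, Measure.restrict_apply measurableSet_Iic, smul_eq_mul,
    ENNReal.ofReal_mul M.lam_pos.le, ← Ici_inter_Iic, inter_left_comm, Iic_inter_Iic,
    Ici_inter_Iic, Real.volume_Icc, sub_zero]
  congr 1
  simp [clip, max_comm]

/-- The number of arrivals up to `t` is almost surely `N` at the clipped time, simultaneously for
all `t`, so only moments of `N` remain. -/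
lemma hasPoissonMoments : HasPoissonMoments P M.intensity (fun ω => M.pathCard (M.path ω))
    fun i ω => M.pathArrival i (M.path ω) := by
  have hcount : ∀ᵐ ω ∂P, ∀ t, ∑ i ∈ Finset.range (M.pathCard (M.path ω)),
      (Iic t).indicator (1 : ℝ → ℝ≥0∞) (M.pathArrival i (M.path ω)) = M.N (M.clip t) ω := by
    filter_upwards [M.poisson.zero, M.poisson.mono, M.poisson.rightCont] with ω h0 h1 h2
    exact M.sum_indicator_pathArrival h0 h1 h2
  refine ⟨M.measurable_pathCard.comp M.measurable_path,
    fun i => (M.measurable_pathArrival i).comp M.measurable_path, fun t => ?_, fun s t => ?_⟩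
  · rw [lintegral_congr_ae (hcount.mono fun ω h => h t), M.lintegral_count (M.clip_mem t),
      M.intensity_Iic]
  · rw [lintegral_congr_ae (hcount.mono fun ω h => congrArg₂ (· * ·) (h s) (h t))]
    simp only [M.intensity_Iic]
    rcases le_total s t with hst | hst
    · rw [M.lintegral_count_mul_count (M.clip_mem s) (M.clip_mem t) (M.clip_mono hst),
        min_eq_left hst]
    · simp only [mul_comm (M.N (M.clip s) _ : ℝ≥0∞)]
      rw [M.lintegral_count_mul_count (M.clip_mem t) (M.clip_mem s) (M.clip_mono hst),
        min_eq_right hst, mul_comm]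

end ClaimModel

/-! ### The mean–variance criterion as an integrated cost, and its pointwise optimisation. -/

lemma integral_add_const_mul_add_const_mul {α : Type*} [MeasurableSpace α] {μ : Measure α}
    {f g h : α → ℝ} (hf : Integrable f μ) (hg : Integrable g μ) (hh : Integrable h μ) (a b : ℝ) :
    ∫ x, (f x + a * g x + b * h x) ∂μ = ∫ x, f x ∂μ + a * ∫ x, g x ∂μ + b * ∫ x, h x ∂μ := by
  have hfg : Integrable (fun x => f x + a * g x) μ := hf.add (hg.const_mul a)
  rw [integral_add hfg (hh.const_mul b), integral_add hf (hg.const_mul a), integral_const_mul,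
    integral_const_mul]

namespace ClaimModel

variable {Ω : Type*} [MeasurableSpace Ω] {P : Measure Ω} (M : ClaimModel P)

lemma ae_pos : ∀ᵐ y ∂M.F, 0 < y := by
  rw [← (M.Y_law 0).map_eq, ae_map_iff (M.Y_law 0).aemeasurable measurableSet_Ioi]
  exact M.Y_pos 0

lemma restrict_Ioi : M.F.restrict (Ioi 0) = M.F :=
  Measure.restrict_eq_self_of_ae_mem M.ae_pos

lemma isProbabilityMeasure_F [IsProbabilityMeasure P] : IsProbabilityMeasure M.F :=
  (M.Y_law 0).isProbabilityMeasure_iff.1 inferInstance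

lemma sFinite_F [IsProbabilityMeasure P] : SFinite M.F :=
  have := M.isProbabilityMeasure_F
  inferInstance

/-- The measure `ds ⊗ dF` on `(t,T] × (0,∞)`. -/
noncomputable def claimMeasure (t : ℝ) : Measure (ℝ × ℝ) :=
  (volume.restrict (Ioc t M.T)).prod M.F

lemma ae_claimMeasure [IsProbabilityMeasure P] {t : ℝ} (ht : 0 ≤ t) :
    ∀ᵐ z ∂M.claimMeasure t, z.1 ∈ Icc 0 M.T ∧ 0 < z.2 := by
  have := M.sFinite_F
  have h1 : ∀ᵐ s ∂volume.restrict (Ioc t M.T), s ∈ Icc 0 M.T := by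
    filter_upwards [ae_restrict_mem measurableSet_Ioc] with s hs
    exact ⟨ht.trans hs.1.le, hs.2⟩
  filter_upwards [Measure.quasiMeasurePreserving_fst.ae h1,
    Measure.quasiMeasurePreserving_snd.ae M.ae_pos] with z hz1 hz2 using ⟨hz1, hz2⟩

lemma claimMeasure_le [IsProbabilityMeasure P] {t : ℝ} (ht : 0 ≤ t) :
    M.claimMeasure t ≤ (volume.restrict (Icc 0 M.T)).prod M.F := by
  have := M.sFinite_F
  exact Measure.prod_mono
    (Measure.restrict_mono (Ioc_subset_Icc_self.trans (Icc_subset_Icc_left ht)) le_rfl) le_rfl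

lemma restrict_intensity_prod [IsProbabilityMeasure P] {t : ℝ} (ht : 0 ≤ t) :
    (M.intensity.prod M.F).restrict (Ioc t M.T ×ˢ Ioi 0)
      = ENNReal.ofReal M.lam • M.claimMeasure t := by
  have := M.sFinite_F
  rw [← Measure.prod_restrict, M.restrict_Ioi, intensity, Measure.restrict_smul,
    Measure.restrict_restrict measurableSet_Ioc, inter_eq_left.2
      (Ioc_subset_Icc_self.trans (Icc_subset_Icc_left ht)), Measure.prod_smul_left]
  rfl

lemma integral_jumpMeasure {ω : Ω} (hmono : MonotoneOn (fun t => M.N t ω) (Icc 0 M.T))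
    {s : Set (ℝ × ℝ)} (hs : MeasurableSet s) (g : ℝ × ℝ → ℝ) :
    ∫ z in s, g z ∂M.jumpMeasure ω = ∑ i ∈ Finset.range (M.pathCard (M.path ω)),
      s.indicator g (M.pathArrival i (M.path ω), M.Y i ω) := by
  rw [← integral_indicator hs, jumpMeasure, integral_finsetSum_measure
    fun i _ => integrable_dirac (by simp)]
  refine Finset.sum_congr rfl fun i hi => ?_
  rw [integral_dirac, M.arrival_eq_pathArrival hmono (Finset.mem_range.1 hi)]

lemma memLp_snd_claimMeasure [IsProbabilityMeasure P] (t : ℝ) :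
    MemLp (fun z : ℝ × ℝ => z.2) 2 (M.claimMeasure t) := by
  have := M.isProbabilityMeasure_F
  have h : MemLp (fun y : ℝ => y) 2 M.F :=
    (memLp_two_iff_integrable_sq measurable_id.aestronglyMeasurable).2 M.Y_sq
  exact h.comp_snd _

variable {M} in
lemma IsCoverage.memLp [IsProbabilityMeasure P] {l : ℝ → ℝ → ℝ} (hl : M.IsCoverage l) {t : ℝ}
    (ht : 0 ≤ t) : MemLp (fun z : ℝ × ℝ => l z.1 z.2) 2 (M.claimMeasure t) :=
  ((memLp_two_iff_integrable_sq hl.measurable.aestronglyMeasurable).2 hl.sq_integrable).mono_measure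
    (M.claimMeasure_le ht)

instance isFiniteMeasure_claimMeasure [IsProbabilityMeasure P] (t : ℝ) :
    IsFiniteMeasure (M.claimMeasure t) := by
  have := M.isProbabilityMeasure_F
  unfold claimMeasure
  infer_instance

lemma integral_premiumRate [IsProbabilityMeasure P] {l : ℝ → ℝ → ℝ} (hl : M.IsCoverage l)
    (xi : ℝ) {t : ℝ} (ht : t ∈ Icc 0 M.T) :
    ∫ s in t..M.T, M.premiumRate xi l s
      = (1 + xi) * M.lam * ∫ z, l z.1 z.2 ∂M.claimMeasure t := by
  have := M.sFinite_F
  have hi : Integrable (fun z : ℝ × ℝ => l z.1 z.2) (M.claimMeasure t) :=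
    (hl.memLp ht.1).integrable (by norm_num)
  unfold premiumRate
  rw [intervalIntegral.integral_of_le ht.2, integral_const_mul, M.restrict_Ioi]
  congr 1
  exact (integral_prod _ hi).symm

/-- The expected cost density of a coverage function: the claim itself, the risk premium and the
variance penalty of the retained loss. -/
noncomputable def cost (xi γ : ℝ) (l : ℝ → ℝ → ℝ) (z : ℝ × ℝ) : ℝ :=
  z.2 + xi * l z.1 z.2 + γ / 2 * (z.2 - l z.1 z.2) ^ 2

lemma integrable_cost [IsProbabilityMeasure P] {l : ℝ → ℝ → ℝ} (hl : M.IsCoverage l)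
    (xi γ : ℝ) {t : ℝ} (ht : 0 ≤ t) : Integrable (cost xi γ l) (M.claimMeasure t) :=
  (((M.memLp_snd_claimMeasure t).integrable (by norm_num)).add
    (((hl.memLp ht).integrable (by norm_num)).const_mul xi)).add
    (((M.memLp_snd_claimMeasure t).sub (hl.memLp ht)).integrable_sq.const_mul (γ / 2))

/-- Campbell's formulas for the retained loss cut off to `(t,T] × (0,∞)`. Admissible coverage may
exceed the claim, so the signed version is needed. -/
lemma moments_retained [IsProbabilityMeasure P] {l : ℝ → ℝ → ℝ} (hl : M.IsCoverage l) {t : ℝ}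
    (ht : t ∈ Icc 0 M.T) :
    MemLp (fun ω => ∫ z in Ioc t M.T ×ˢ Ioi 0, (z.2 - l z.1 z.2) ∂M.jumpMeasure ω) 2 P ∧
    ∫ ω, ∫ z in Ioc t M.T ×ˢ Ioi 0, (z.2 - l z.1 z.2) ∂M.jumpMeasure ω ∂P
      = M.lam * ∫ z, (z.2 - l z.1 z.2) ∂M.claimMeasure t ∧
    Var[fun ω => ∫ z in Ioc t M.T ×ˢ Ioi 0, (z.2 - l z.1 z.2) ∂M.jumpMeasure ω; P]
      = M.lam * ∫ z, (z.2 - l z.1 z.2) ^ 2 ∂M.claimMeasure t := by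
  have := M.isProbabilityMeasure_F
  have hs : MeasurableSet (Ioc t M.T ×ˢ Ioi (0 : ℝ)) := measurableSet_Ioc.prod measurableSet_Ioi
  set s := Ioc t M.T ×ˢ Ioi (0 : ℝ)
  set g : ℝ × ℝ → ℝ := fun z => z.2 - l z.1 z.2
  have hg : Measurable g := measurable_snd.sub hl.measurable
  have hg2 : MemLp (s.indicator g) 2 (M.intensity.prod M.F) := by
    rw [memLp_indicator_iff_restrict hs, M.restrict_intensity_prod ht.1]
    exact ((M.memLp_snd_claimMeasure t).sub (hl.memLp ht.1)).smul_measure ENNReal.ofReal_ne_top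
  obtain ⟨h1, h2, h3⟩ := moments_sum_marked M.measurable_path M.Y_law M.Y_indep M.N_Y_indep
    M.measurable_pathCard M.measurable_pathArrival M.hasPoissonMoments (hg.indicator hs) hg2
  have hae : (fun ω => ∫ z in s, g z ∂M.jumpMeasure ω) =ᵐ[P]
      fun ω => ∑ i ∈ Finset.range (M.pathCard (M.path ω)),
        s.indicator g (M.pathArrival i (M.path ω), M.Y i ω) := by
    filter_upwards [M.poisson.mono] with ω hω using M.integral_jumpMeasure hω hs g
  have hint : ∀ f : ℝ × ℝ → ℝ, ∫ z in s, f z ∂(M.intensity.prod M.F)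
      = M.lam * ∫ z, f z ∂M.claimMeasure t := fun f => by
    rw [M.restrict_intensity_prod ht.1, integral_smul_measure,
      ENNReal.toReal_ofReal M.lam_pos.le, smul_eq_mul]
  refine ⟨(memLp_congr_ae hae).2 h1, ?_, ?_⟩
  · rw [integral_congr_ae hae, h2, integral_indicator hs, hint]
  · rw [variance_congr hae, h3, ← hint, ← integral_indicator hs]
    refine integral_congr_ae (ae_of_all _ fun z => ?_)
    by_cases hz : z ∈ s <;> simp [hz, g]

lemma memLp_surplusFrom [IsProbabilityMeasure P] {l : ℝ → ℝ → ℝ} (hl : M.IsCoverage l)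
    (xi x : ℝ) {t : ℝ} (ht : t ∈ Icc 0 M.T) : MemLp (M.surplusFrom xi l t x M.T) 2 P :=
  (memLp_const (x - ∫ s in t..M.T, M.premiumRate xi l s)).sub (M.moments_retained hl ht).1

/-- The mean–variance criterion as an integral of the cost density. -/
lemma J_eq [IsProbabilityMeasure P] {l : ℝ → ℝ → ℝ} (hl : M.IsCoverage l)
    (xi γ x : ℝ) {t : ℝ} (ht : t ∈ Icc 0 M.T) :
    M.J xi γ t x l = x - M.lam * ∫ z, cost xi γ l z ∂M.claimMeasure t := by
  obtain ⟨h1, h2, h3⟩ := M.moments_retained hl ht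
  have hy := M.memLp_snd_claimMeasure t
  have hl2 := hl.memLp ht.1
  have hmean : ∫ ω, M.surplusFrom xi l t x M.T ω ∂P = x - (∫ s in t..M.T, M.premiumRate xi l s)
      - M.lam * ∫ z, (z.2 - l z.1 z.2) ∂M.claimMeasure t := by
    unfold surplusFrom
    rw [integral_sub (integrable_const _) (h1.integrable (by norm_num)), h2]
    simp
  have hvar : variance (M.surplusFrom xi l t x M.T) P
      = M.lam * ∫ z, (z.2 - l z.1 z.2) ^ 2 ∂M.claimMeasure t := by
    unfold surplusFrom
    rw [variance_const_sub h1.aestronglyMeasurable, h3]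
  have hcost : ∫ z, cost xi γ l z ∂M.claimMeasure t
      = ∫ z, z.2 ∂M.claimMeasure t + xi * ∫ z, l z.1 z.2 ∂M.claimMeasure t
        + γ / 2 * ∫ z, (z.2 - l z.1 z.2) ^ 2 ∂M.claimMeasure t := by
    exact integral_add_const_mul_add_const_mul (hy.integrable (by norm_num))
      (hl2.integrable (by norm_num)) (hy.sub hl2).integrable_sq xi (γ / 2)
  unfold J
  rw [hmean, hvar, hcost, M.integral_premiumRate hl xi ht,
    integral_sub (hy.integrable (by norm_num)) (hl2.integrable (by norm_num))]
  ring

lemma isIndemnity_excessOfLoss {d : ℝ} (hd : 0 ≤ d) : M.IsIndemnity (excessOfLoss d) where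
  measurable := by
    unfold excessOfLoss Function.uncurry
    fun_prop
  bounds _ _ y hy := ⟨le_max_right _ _, max_le (by linarith) hy.le⟩

/-- With `d = ξ/γ`, the excess cost of `l` is `γ l (d - y) + (γ/2) l²` when `y ≤ d` and `(γ/2)(y - l
- d)²` when `y ≥ d`. -/
lemma cost_excessOfLoss_le {xi γ : ℝ} (hxi : 0 ≤ xi) (hγ : 0 < γ) {l : ℝ → ℝ → ℝ} {z : ℝ × ℝ}
    (hl : 0 ≤ l z.1 z.2) : cost xi γ (excessOfLoss (xi / γ)) z ≤ cost xi γ l z := by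
  obtain ⟨d, rfl⟩ : ∃ d, xi = γ * d := ⟨xi / γ, by field_simp⟩
  rw [mul_div_cancel_left₀ _ hγ.ne']
  unfold cost excessOfLoss
  rcases le_total z.2 d with h | h
  · rw [max_eq_right (by linarith)]
    nlinarith [mul_nonneg hγ.le (mul_nonneg hl (sub_nonneg.2 h)),
      mul_nonneg hγ.le (sq_nonneg (l z.1 z.2))]
  · rw [max_eq_left (by linarith)]
    nlinarith [mul_nonneg hγ.le (sq_nonneg (z.2 - l z.1 z.2 - d))]

lemma J_le_J_excessOfLoss [IsProbabilityMeasure P] {xi γ : ℝ} (hxi : 0 ≤ xi) (hγ : 0 < γ)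
    {l : ℝ → ℝ → ℝ} (hl : M.IsCoverage l) (hd : M.IsCoverage (excessOfLoss (xi / γ))) (x : ℝ)
    {t : ℝ} (ht : t ∈ Icc 0 M.T) :
    M.J xi γ t x l ≤ M.J xi γ t x (excessOfLoss (xi / γ)) := by
  rw [M.J_eq hl xi γ x ht, M.J_eq hd xi γ x ht]
  refine sub_le_sub_left (mul_le_mul_of_nonneg_left ?_ M.lam_pos.le) x
  refine integral_mono_ae (M.integrable_cost hd xi γ ht.1) (M.integrable_cost hl xi γ ht.1) ?_
  filter_upwards [M.ae_claimMeasure ht.1] with z hz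
  exact cost_excessOfLoss_le hxi hγ (hl.nonneg z.1 hz.1 z.2 hz.2)

lemma J_excessOfLoss [IsProbabilityMeasure P] {d : ℝ} (hd : M.IsCoverage (excessOfLoss d))
    (xi γ x : ℝ) :
    M.J xi γ 0 x (excessOfLoss d) = x - M.lam * M.T * ((∫ y, y ∂M.F)
        + xi * (∫ y in Ioi d, (y - d) ∂M.F) + γ / 2 * ∫ y in Ioi 0, (min y d) ^ 2 ∂M.F) := by
  have := M.isProbabilityMeasure_F
  have hy : MemLp (fun y : ℝ => y) 2 M.F :=
    (memLp_two_iff_integrable_sq measurable_id.aestronglyMeasurable).2 M.Y_sq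
  have hyd : MemLp (fun y : ℝ => max (y - d) 0) 2 M.F := (hy.sub (memLp_const d)).pos_part
  have hmin : ∀ y : ℝ, y - max (y - d) 0 = min y d := fun y => by
    rcases le_total y d with h | h
    · rw [max_eq_right (by linarith), min_eq_left h, sub_zero]
    · rw [max_eq_left (by linarith), min_eq_right h, sub_sub_cancel]
  have hmin2 : Integrable (fun y : ℝ => min y d ^ 2) M.F := by
    simp only [← hmin]
    exact (hy.sub hyd).integrable_sq
  have hIoi : ∫ y in Ioi d, (y - d) ∂M.F = ∫ y, max (y - d) 0 ∂M.F := by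
    rw [← integral_indicator measurableSet_Ioi]
    refine integral_congr_ae (ae_of_all _ fun y => ?_)
    by_cases h : d < y
    · simp [h, h.le]
    · simp [h, not_lt.1 h]
  -- The retained loss is `min y d` at all times, so integrating over time contributes the factor
  -- `T`.
  have hcost : ∫ z, cost xi γ (excessOfLoss d) z ∂M.claimMeasure 0
      = M.T * ∫ y, (y + xi * max (y - d) 0 + γ / 2 * min y d ^ 2) ∂M.F := by
    simp only [cost, excessOfLoss, hmin]
    rw [claimMeasure, integral_fun_snd (fun y => y + xi * max (y - d) 0 + γ / 2 * min y d ^ 2)]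
    simp [M.T_pos.le]
  rw [M.J_eq hd xi γ x ⟨le_rfl, M.T_pos.le⟩, hcost, hIoi, M.restrict_Ioi,
    integral_add_const_mul_add_const_mul (hy.integrable (by norm_num))
      (hyd.integrable (by norm_num)) hmin2]
  ring

end ClaimModel

theorem theorem3p2 {Ω : Type*} [MeasurableSpace Ω] (P : Measure Ω) [IsProbabilityMeasure P]
    (M : ClaimModel P)
    -- the admissible set: any class between the two natural ones
    (A : Set (ℝ → ℝ → ℝ)) (hA₁ : ∀ l, M.IsIndemnity l → l ∈ A) (hA₂ : ∀ l ∈ A, M.IsCoverage l)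
    (γL γH : ℝ) (hγL : 0 ≤ γL) (xC : ℝ) (hxC : 0 < xC)
    -- the admissible loading function, the true and the reported risk aversion
    (ξ : ℝ → ℝ) (hξ : ∀ g ∈ Icc γL γH, 0 ≤ ξ g)
    (γ : ℝ) (hγ : γ ∈ Icc γL γH) (hγ_pos : 0 < γ) (γ' : ℝ) (hγ' : γ' ∈ Icc γL γH) :
    -- all means and variances involved are finite
    (∀ l ∈ A, ∀ t ∈ Icc 0 M.T, ∀ x : ℝ, MemLp (M.surplusFrom (ξ γ') l t x M.T) 2 P) ∧
    -- `(y - ξ(γ')/γ)_+` is an equilibrium strategy, and it attains the supremum of the objective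
    M.IsEquilibrium A (ξ γ') γ (excessOfLoss (ξ γ' / γ)) ∧
    IsMaxOn (M.objective (ξ γ') γ xC) A (excessOfLoss (ξ γ' / γ)) ∧
    -- the value function is the (equilibrium) value of that strategy, given explicitly
    M.valueFunction A (ξ γ') γ xC = (M.J (ξ γ') γ 0 xC (excessOfLoss (ξ γ' / γ)) : EReal) ∧
    M.J (ξ γ') γ 0 xC (excessOfLoss (ξ γ' / γ)) =
      xC - M.lam * M.T * ((∫ y, y ∂M.F)
        + ξ γ' * (∫ y in Ioi (ξ γ' / γ), (y - ξ γ' / γ) ∂M.F)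
        + γ / 2 * ∫ y in Ioi 0, (min y (ξ γ' / γ)) ^ 2 ∂M.F) := by
  have hd0 : 0 ≤ ξ γ' / γ := div_nonneg (hξ γ' hγ') hγ_pos.le
  have hdA := hA₁ _ (M.isIndemnity_excessOfLoss hd0)
  have hdC := hA₂ _ hdA
  have h0 : (0 : ℝ) ∈ Icc 0 M.T := ⟨le_rfl, M.T_pos.le⟩
  -- `objective` is `J` at time `0` by unfolding.
  have hmax : IsMaxOn (M.objective (ξ γ') γ xC) A (excessOfLoss (ξ γ' / γ)) := fun l hl =>
    M.J_le_J_excessOfLoss (hξ γ' hγ') hγ_pos (hA₂ l hl) hdC xC h0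
  refine ⟨fun l hl t ht x => M.memLp_surplusFrom (hA₂ l hl) _ x ht, ⟨hdA, ?_⟩, hmax, ?_,
    M.J_excessOfLoss hdC _ _ _⟩
  · intro t ht x lbar hlbar
    -- Each perturbed strategy is itself admissible, hence no better than the optimum from time `t`.
    refine le_liminf_of_le (by isBoundedDefault) ?_
    filter_upwards [hlbar, self_mem_nhdsWithin] with ε hε hεpos
    exact EReal.coe_nonneg.2 (div_nonneg (sub_nonneg.2
      (M.J_le_J_excessOfLoss (hξ γ' hγ') hγ_pos (hA₂ _ hε) hdC x ht)) (le_of_lt hεpos))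
  · exact le_antisymm (iSup₂_le fun l hl => EReal.coe_le_coe_iff.2 (hmax hl))
      (le_iSup₂ (f := fun l _ => ((M.objective (ξ γ') γ xC l : ℝ) : EReal)) _ hdA)
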